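/- Let $n\ge 1$, let $U\subseteq\mathbb R^n$ be open, and identify $T^*U=U\times\mathbb R^n$ with coordinates $(x,\xi)$; $|\xi|$ is the Euclidean norm. A symbol of real order $r$ on $U$ is a smooth $\sigma:T^*U\to\mathbb C$ such that for every compact $K\subset U$ and all multi-indices $\alpha,\beta$ there is $C$ with $|\partial_x^\alpha\partial_\xi^\beta\sigma(x,\xi)|\le C(1+|\xi|)^{r-|\beta|}$ for $x\in K$, $\xi\in\mathbb R^n$. For $m\in\mathbb C$, a symbol $\sigma$ of order $\operatorname{Re} m$ is a classical symbol of order $m$ if there are smooth functions $\sigma_{m-j}$ ($j\ge 0$) on $U\times(\mathbb R^n\setminus\{0\})$, with $\sigma_{m-j}(x,t\xi)=t^{m-j}\sigma_{m-j}(x,\xi)$ for $t>0$, such that $\sigma-\sum_{j=0}^N\chi\,\sigma_{m-j}$ is a symbol of order $\operatorname{Re}m-N-1$ for every $N\ge 0$, where $\chi$ is a smooth function on $T^*U$ with $\chi=0$ for $|\xi|\le 1/2$ and $\chi=1$ for $|\xi|\ge1$. Let $CS^m_{com}(U)$ be the set of those which vanish for $x$ outside some compact subset of $U$, and let $CS_{com}(U)$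 be the linear span of $\bigcup_{m\in\mathbb C}CS^m_{com}(U)$ (which is also the algebra generated by this union). For $\sigma=\sum_k\tau_k\in CS_{com}(U)$ (finite sum) with $\tau_k\in CS^{m_k}_{com}(U)$, and $a\in\mathbb C$, the homogeneous component $\sigma_a$ of degree $a$ is the sum of the components $(\tau_k)_{m_k-j}$ with $m_k-j=a$. For $\tau\in CS_{com}(U)$ the cut-off integral is $$⨍_{T^*U}\tau(x,\xi)\,d\xi\,dx:=\int_U\Big(\operatorname{fp}_{R\to\infty}\int_{|\xi|<R}\tau(x,\xi)\,d\xi\Big)dx,$$ where $\operatorname{fp}_{R\to\infty}f(R)$ is the constant term $c$ of an expansion $f(R)=c+\sum_z a_zR^z+b\log R+o(1)$ with finitely many complex exponents $z\ne0$. Then for every $\sigma\in CS_{com}(U)$ and $i\in\{1,\dots,n\}$ the finite parts defining $⨍_{T^*U}\frac{\partial}{\partial\xi_i}\sigma\,d\xi\,dx$ exist for all $x\in U$ and are integrable over $U$, the component $\sigma_{-n+1}$ exists, and $$⨍_{T^*U}\frac{\partial}{\partial\xi_i}\sigma(x,\xi)\,d\xi\,dx=(-1)^{i-1}\int_{S^*U}\sigma_{-n+1}(x,\xi)\,d\xi_1\wedge\cdots\wedge\widehat{d\xi_i}\wedge\cdots\wedge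 d\xi_n\wedge dx_1\wedge\cdots\wedge dx_n,$$ where $S^*U=\{(x,\xi)\in T^*U:|\xi|=1\}$; the right-hand integral is computed by integrating over each fibre sphere, oriented as the boundary of the unit ball of $\mathbb R^n$, and then over $U$ with respect to $dx$; the result of the fibre integration is integrable over $U$. In particular $$⨍_{T^*U}\frac{\partial}{\partial\xi_i}\sigma(x,\xi)\,d\xi\,dx=0$$ if $\sigma$ has non-integer order, i.e. if $\sigma\in CS^m_{com}(U)$ with $m\notin\mathbb Z$, and more generally if $\sigma$ is a finite sum of such symbols, of possibly different non-integer orders. -/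

import Mathlib

open Set Filter Topology MeasureTheory
open scoped ContDiff

namespace CutoffIBP

noncomputable section

/-- `ℝⁿ` with its Euclidean norm. The cotangent bundle of an open set `U ⊆ ℝⁿ` is `U × ℝⁿ`; a
function on it is written as a curried function `σ : V n → V n → ℂ`, `(x, ξ) ↦ σ x ξ`, of which only
the values at `x ∈ U` matter. -/
abbrev V (n : ℕ) : Type := EuclideanSpace ℝ (Fin n)

/-- The `i`-th standard basis vector. -/
def basisVec {n : ℕ} (i : Fin n) : V n := EuclideanSpace.single i (1 : ℝ)

/-- `∂σ/∂x_i`. -/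
def partialX {n : ℕ} (i : Fin n) (σ : V n → V n → ℂ) : V n → V n → ℂ :=
  fun x ξ => fderiv ℝ (fun y => σ y ξ) x (basisVec i)

/-- `∂σ/∂ξ_i`. -/
def partialXi {n : ℕ} (i : Fin n) (σ : V n → V n → ℂ) : V n → V n → ℂ :=
  fun x ξ => fderiv ℝ (σ x) ξ (basisVec i)

/-- The mixed derivative `∂_x^α ∂_ξ^β σ`, with multi-indices given as lists of coordinates
(so `|α|`, `|β|` are the lengths of the lists). -/
def mixedDeriv {n : ℕ} (α β : List (Fin n)) (σ : V n → V n → ℂ) : V n → V n → ℂ :=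
  α.foldr partialX (β.foldr partialXi σ)

/-- Symbols of real order `r` on `U`: smooth functions on `T*U` with
`|∂_x^α ∂_ξ^β σ(x, ξ)| ≤ C (1 + |ξ|)^(r - |β|)` for `x` in a compact subset of `U`. -/
structure IsSymbol {n : ℕ} (U : Set (V n)) (r : ℝ) (σ : V n → V n → ℂ) : Prop where
  smooth : ContDiffOn ℝ ∞ (Function.uncurry σ) (U ×ˢ univ)
  bound : ∀ K : Set (V n), IsCompact K → K ⊆ U → ∀ α β : List (Fin n),
    ∃ C : ℝ, ∀ x ∈ K, ∀ ξ : V n,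
      ‖mixedDeriv α β σ x ξ‖ ≤ C * (1 + ‖ξ‖) ^ (r - (β.length : ℝ))

/-- Excision functions: smooth on `T*U`, `0` for `|ξ| ≤ 1/2` and `1` for `|ξ| ≥ 1`. -/
structure IsExcision {n : ℕ} (U : Set (V n)) (χ : V n → V n → ℝ) : Prop where
  smooth : ContDiffOn ℝ ∞ (Function.uncurry χ) (U ×ˢ univ)
  eq_zero : ∀ x ∈ U, ∀ ξ : V n, ‖ξ‖ ≤ 1 / 2 → χ x ξ = 0
  eq_one : ∀ x ∈ U, ∀ ξ : V n, 1 ≤ ‖ξ‖ → χ x ξ = 1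

/-- Smooth functions on `T*U` minus the zero section that are positively homogeneous of
degree `a` in `ξ`. -/
structure IsPosHomogeneous {n : ℕ} (U : Set (V n)) (a : ℂ) (h : V n → V n → ℂ) : Prop where
  smooth : ContDiffOn ℝ ∞ (Function.uncurry h) (U ×ˢ {0}ᶜ)
  homogeneous : ∀ x ∈ U, ∀ ξ : V n, ξ ≠ 0 → ∀ t : ℝ, 0 < t →
    h x (t • ξ) = (t : ℂ) ^ a * h x ξ

/-- `σ ∼ ∑_j χ c_j` is a classical symbol of complex order `m`, and `c j` is its positively
homogeneous component of degree `m - j`. (The notion does not depend on the excision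
function `χ`.) -/
structure IsClassicalExpansion {n : ℕ} (U : Set (V n)) (m : ℂ) (σ : V n → V n → ℂ)
    (c : ℕ → V n → V n → ℂ) : Prop where
  symbol : IsSymbol U m.re σ
  homogeneous : ∀ j : ℕ, IsPosHomogeneous U (m - (j : ℂ)) (c j)
  remainder : ∃ χ : V n → V n → ℝ, IsExcision U χ ∧ ∀ N : ℕ,
    IsSymbol U (m.re - (N : ℝ) - 1)
      (fun x ξ => σ x ξ - ∑ j ∈ Finset.range (N + 1), (χ x ξ : ℂ) * c j x ξ)

/-- Compact support in `U`, that is, in the `x`-variable. -/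
def HasCompactSupportIn {n : ℕ} (U : Set (V n)) (σ : V n → V n → ℂ) : Prop :=
  ∃ K : Set (V n), IsCompact K ∧ K ⊆ U ∧ ∀ x ∈ U, x ∉ K → ∀ ξ : V n, σ x ξ = 0

/-- `CS_com^m(U)`: classical symbols of order `m` with compact support in `U`. -/
def CScomOrder {n : ℕ} (U : Set (V n)) (m : ℂ) : Set (V n → V n → ℂ) :=
  {σ | (∃ c, IsClassicalExpansion U m σ c) ∧ HasCompactSupportIn U σ}

/-- `CS_com(U)`: finite sums of classical symbols of arbitrary complex orders with compact support
in `U`. The product of symbols of orders `m`, `m'` has order `m + m'`, so this span is the algebra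
generated by these symbols. -/
def CScom {n : ℕ} (U : Set (V n)) : Submodule ℂ (V n → V n → ℂ) :=
  Submodule.span ℂ (⋃ m : ℂ, CScomOrder U m)

/-- Finite sums of compactly supported classical symbols of non-integer orders; in particular every
element of `CS_com^m(U)` with `m ∉ ℤ`. -/
def CScomNonInt {n : ℕ} (U : Set (V n)) : Submodule ℂ (V n → V n → ℂ) :=
  Submodule.span ℂ (⋃ m ∈ {m : ℂ | ∀ k : ℤ, m ≠ (k : ℂ)}, CScomOrder U m)

/-- `h` is the positively homogeneous component `σ_a` of degree `a` of `σ ∈ CS_com(U)`: for a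
decomposition of `σ` into classical symbols `τ k` of orders `m k` with compact support and with
components `c k j` of degree `m k - j`, it is the sum of all components `c k j` of degree `a`
(there is at most one such `j` for each `k`). -/
def IsHomComponent {n : ℕ} (U : Set (V n)) (σ : V n → V n → ℂ) (a : ℂ)
    (h : V n → V n → ℂ) : Prop :=
  ∃ (p : ℕ) (m : Fin p → ℂ) (τ : Fin p → V n → V n → ℂ) (c : Fin p → ℕ → V n → V n → ℂ),
    (∀ k, IsClassicalExpansion U (m k) (τ k) (c k)) ∧
    (∀ k, HasCompactSupportIn U (τ k)) ∧
    (∀ x ∈ U, ∀ ξ : V n, σ x ξ = ∑ k, τ k x ξ) ∧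
    (∀ x ∈ U, ∀ ξ : V n, ξ ≠ 0 →
      h x ξ = ∑ k, ∑ᶠ (j : ℕ) (_ : m k - (j : ℂ) = a), c k j x ξ)

/-- `c` is the constant term (finite part) in an asymptotic expansion
`f R = c + ∑_z a_z R^z + b log R + o(1)` as `R → ∞`, with finitely many non-zero complex
exponents `z`. -/
def HasFinitePart (f : ℝ → ℂ) (c : ℂ) : Prop :=
  ∃ (s : Finset ℂ) (a : ℂ → ℂ) (b : ℂ), (0 : ℂ) ∉ s ∧
    Tendsto (fun R : ℝ => f R - (c + ∑ z ∈ s, a z * (R : ℂ) ^ z + b * (Real.log R : ℂ)))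
      atTop (𝓝 0)

open Classical in
/-- The finite part `fp_{R → ∞} f R` (`0` if there is none). -/
def finitePart (f : ℝ → ℂ) : ℂ :=
  if h : ∃ c, HasFinitePart f c then h.choose else 0

/-- `R ↦ ∫_{B_x^*(0, R)} σ(x, ξ) dξ`. -/
def ballIntegral {n : ℕ} (σ : V n → V n → ℂ) (x : V n) (R : ℝ) : ℂ :=
  ∫ ξ in Metric.ball (0 : V n) R, σ x ξ

/-- The cut-off integral of `σ` over the fibre `T_x^*U`. -/
def fibreCutoff {n : ℕ} (σ : V n → V n → ℂ) (x : V n) : ℂ :=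
  finitePart (ballIntegral σ x)

/-- The cut-off integral of `σ` over `T^*U`. -/
def cutoffIntegral {n : ℕ} (U : Set (V n)) (σ : V n → V n → ℂ) : ℂ :=
  ∫ x in U, fibreCutoff σ x

/-- Every unit vector starts an orthonormal basis. -/
theorem exists_frame {d : ℕ} (ξ : Metric.sphere (0 : V (d + 1)) 1) :
    ∃ e : OrthonormalBasis (Fin (d + 1)) ℝ (V (d + 1)), e 0 = ξ := by
  have h : Orthonormal ℝ (({0} : Set (Fin (d + 1))).domRestrict (fun _ => (ξ : V (d + 1)))) := by
    constructor
    · intro i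
      exact norm_eq_of_mem_sphere ξ
    · intro i j hij
      exact absurd (Subsingleton.elim i j) hij
  obtain ⟨b, hb⟩ := Orthonormal.exists_orthonormalBasis_extension_of_card_eq (𝕜 := ℝ)
    (E := V (d + 1)) (ι := Fin (d + 1)) (by simp) h
  exact ⟨b, hb 0 rfl⟩

/-- An orthonormal basis of `ℝ^(d+1)` that starts with the outer unit normal `ξ` of the unit
sphere at `ξ`; the other vectors form an orthonormal basis of the tangent space. -/
def frame {d : ℕ} (ξ : Metric.sphere (0 : V (d + 1)) 1) :
    OrthonormalBasis (Fin (d + 1)) ℝ (V (d + 1)) :=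
  (exists_frame ξ).choose

/-- The integral of a `d`-form on `ℝ^(d+1)` over the unit sphere, oriented as the boundary of
the unit ball: the integral against surface measure of the value of the form on a positively
oriented orthonormal tangent frame. The determinant is `±1` and is the orientation of the frame
(for `d = 0` it is the orientation of the point `ξ`). -/
def sphereFormIntegral {d : ℕ} (α : V (d + 1) → (V (d + 1)) [⋀^Fin d]→ₗ[ℝ] ℂ) : ℂ :=
  ∫ ξ : Metric.sphere (0 : V (d + 1)) 1,
    (((Matrix.of fun j k => frame ξ j k).det : ℝ) : ℂ) * α ξ (fun j => frame ξ j.succ)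
    ∂((volume : Measure (V (d + 1))).toSphere)

/-- The form `dξ_1 ∧ ⋯ ∧ dξ_n` with the factor `dξ_i` omitted, for `n = d + 1`: its value on
`v_1, …, v_d` is the determinant of the coordinates other than the `i`-th. -/
def dxiHat {d : ℕ} (i : Fin (d + 1)) : (V (d + 1)) [⋀^Fin d]→ₗ[ℝ] ℝ :=
  (Matrix.detRowAlternating (n := Fin d) (R := ℝ)).compLinearMap
    (LinearMap.pi fun k : Fin d =>
      (EuclideanSpace.proj (𝕜 := ℝ) (i.succAbove k) : V (d + 1) →L[ℝ] ℝ).toLinearMap)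

/-- The complex-valued form `f(ξ) dξ_1 ∧ ⋯ ∧ dξ_n` with `dξ_i` omitted. -/
def smulDxiHat {d : ℕ} (f : V (d + 1) → ℂ) (i : Fin (d + 1)) :
    V (d + 1) → (V (d + 1)) [⋀^Fin d]→ₗ[ℝ] ℂ :=
  fun ξ => f ξ • (Complex.ofRealCLM.toLinearMap.compAlternatingMap (dxiHat i))

/-- The integral over the fibre `S_x^*U` of the unit cosphere bundle of
`h(x, ξ) dξ_1 ∧ ⋯ ∧ dξ_n` with `dξ_i` omitted. -/
def fibreCosphere {d : ℕ} (h : V (d + 1) → V (d + 1) → ℂ) (i : Fin (d + 1))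
    (x : V (d + 1)) : ℂ :=
  sphereFormIntegral (smulDxiHat (h x) i)

/-- The integral over the unit cosphere bundle `S^*U` of
`h(x, ξ) dξ_1 ∧ ⋯ ∧ dξ_n ∧ dx_1 ∧ ⋯ ∧ dx_n` with `dξ_i` omitted. -/
def cosphereIntegral {d : ℕ} (U : Set (V (d + 1))) (h : V (d + 1) → V (d + 1) → ℂ)
    (i : Fin (d + 1)) : ℂ :=
  ∫ x in U, fibreCosphere h i x

end

end CutoffIBP

/-!
Fix `x ∈ U`. By the divergence theorem the integral of `∂σ/∂ξ_i` over the ball of radius `R` in the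
fibre is the flux `R ^ d ∫ σ(x, R θ) θ_i dθ` over the unit sphere, where `n = d + 1`. Inserting the
expansions of the classical symbols that make up `σ`, this becomes, up to `o(1)`, a finite sum of
terms `R ^ (m - j + d) ∫ σ_{m-j}(x, θ) θ_i dθ`. Hence the finite part exists, and only the component
of degree `-d = -n + 1` contributes to it: it equals `∫ σ_{-n+1}(x, θ) θ_i dθ` (`sphereFlux`; see
`IsHomComponent.hasFinitePart`). On the unit sphere `θ_i dθ` is, up to the sign `(-1)^(i-1)`, the
form `dξ_1 ∧ ⋯ ∧ dξ_n` with `dξ_i` omitted (`det_frame_mul_dxiHat`), and integration over `U` gives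
the theorem. Three ingredients need an argument.

* The finite part is well defined (`HasFinitePart.unique`): a combination of `1`, `log R` and powers
  `R ^ z` with `z ≠ 0` tends to `0` only if its constant term vanishes. Exponents with real part `0`
  are allowed, so comparing orders of growth is not enough; instead the powers are removed by
  finite differences with respect to dilations.
* The divergence theorem on balls (`setIntegral_ball_fderiv`) is tested against radial functions
  `φ(|ξ|)`: integration by parts on the whole space, polar coordinates, and a one-dimensional
  integration by parts show that the difference of its two sides, which is continuous in `R`, has
  vanishing integral against every test function on `(0, ∞)`.
* Integrability over `U`: the flux is continuous in `x`, and it has compact support because it is a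
  finite part of integrals that vanish wherever `σ` does.

If `σ` is a sum of symbols of non-integer orders, `0` is a component of degree `-n + 1`.
-/

namespace CutoffIBP

/-! ### Finite parts -/

/-- For `z ≠ 0` the function `R ↦ R ^ z` is not multiplicatively trivial. -/
theorem exists_pos_cpow_ne_one {z : ℂ} (hz : z ≠ 0) : ∃ l : ℝ, 0 < l ∧ (l : ℂ) ^ z ≠ 1 := by
  by_contra! h
  have h1 : ∀ t : ℝ, Complex.exp (t * z) = 1 := by
    intro t
    have := h (Real.exp t) (Real.exp_pos t)
    rwa [Complex.cpow_def_of_ne_zero (by exact_mod_cast (Real.exp_pos t).ne'),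
      ← Complex.ofReal_log (Real.exp_pos t).le, Real.log_exp] at this
  have h2 : HasDerivAt (fun t : ℝ => Complex.exp ((t : ℂ) * z)) (Complex.exp ((0 : ℝ) * z) * (1 * z))
      0 :=
    ((Complex.ofRealCLM.hasDerivAt (x := (0 : ℝ))).mul_const z).cexp
  have h3 : HasDerivAt (fun t : ℝ => Complex.exp ((t : ℂ) * z)) 0 0 := by
    simpa only [h1] using hasDerivAt_const (0 : ℝ) (1 : ℂ)
  exact hz (by simpa using h2.unique h3)

/-- A combination of `1`, `log R` and finitely many `R ^ z`, `z ≠ 0`, that tends to `0` has vanishing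
constant and logarithmic coefficients. The exponents are removed one at a time, by passing from
`g R` to `g (l * R) - l ^ z * g R` for some `l` with `l ^ z ≠ 1`. -/
theorem coeff_eq_zero_of_tendsto_zero (s : Finset ℂ) :
    ∀ (a : ℂ → ℂ) (b c : ℂ), (0 : ℂ) ∉ s →
      Tendsto (fun R : ℝ => c + ∑ z ∈ s, a z * (R : ℂ) ^ z + b * (Real.log R : ℂ)) atTop (𝓝 0) →
      c = 0 ∧ b = 0 := by
  induction s using Finset.induction_on with
  | empty =>
    intro a b c _ h
    simp only [Finset.sum_empty, add_zero] at h
    have hinv : Tendsto (fun R : ℝ => ((Real.log R)⁻¹ : ℂ)) atTop (𝓝 0) := by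
      have := Complex.continuous_ofReal.tendsto 0 |>.comp
        (tendsto_inv_atTop_zero.comp Real.tendsto_log_atTop)
      simpa [Function.comp_def] using this
    have hb : b = 0 := by
      have h1 := (h.mul hinv).sub (hinv.const_mul c)
      have h2 : Tendsto (fun _ : ℝ => b) atTop (𝓝 (0 * 0 - c * 0)) := by
        refine h1.congr' ?_
        filter_upwards [eventually_gt_atTop 1] with R hR
        have : (Real.log R : ℂ) ≠ 0 := by exact_mod_cast (Real.log_pos hR).ne'
        field_simp
        ring
      simpa using tendsto_nhds_unique tendsto_const_nhds h2
    subst hb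
    simp only [zero_mul, add_zero] at h
    exact ⟨tendsto_nhds_unique tendsto_const_nhds h, rfl⟩
  | insert w s hw ih =>
    intro a b c h0 h
    rw [Finset.mem_insert, not_or] at h0
    obtain ⟨l, hl, hlw⟩ := exists_pos_cpow_ne_one (Ne.symm h0.1)
    have hl' : Tendsto (fun R : ℝ => l * R) atTop atTop := tendsto_id.const_mul_atTop hl
    have h1 := (h.comp hl').sub (h.const_mul ((l : ℂ) ^ w))
    have key := ih (fun z => a z * ((l : ℂ) ^ z - (l : ℂ) ^ w)) (b * (1 - (l : ℂ) ^ w))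
      (c * (1 - (l : ℂ) ^ w) + b * (Real.log l : ℂ)) h0.2 (by
        rw [mul_zero, sub_zero] at h1
        refine h1.congr' ?_
        filter_upwards [eventually_gt_atTop 0] with R hR
        have e : ∀ z : ℂ, ((l * R : ℝ) : ℂ) ^ z = (l : ℂ) ^ z * (R : ℂ) ^ z := fun z => by
          rw [Complex.ofReal_mul, Complex.mul_cpow_ofReal_nonneg hl.le hR.le]
        simp only [Function.comp_apply, Finset.sum_insert hw, e, Real.log_mul hl.ne' hR.ne',
          Complex.ofReal_add]
        have e2 : ∑ z ∈ s, a z * ((l : ℂ) ^ z - (l : ℂ) ^ w) * (R : ℂ) ^ z =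
            ∑ z ∈ s, a z * ((l : ℂ) ^ z * (R : ℂ) ^ z) -
              (l : ℂ) ^ w * ∑ z ∈ s, a z * (R : ℂ) ^ z := by
          rw [Finset.mul_sum, ← Finset.sum_sub_distrib]
          exact Finset.sum_congr rfl fun z _ => by ring
        rw [e2]
        ring)
    have hne : (1 : ℂ) - (l : ℂ) ^ w ≠ 0 := sub_ne_zero.2 hlw.symm
    have hb : b = 0 := (mul_eq_zero.1 key.2).resolve_right hne
    refine ⟨?_, hb⟩
    have := key.1
    rw [hb, zero_mul, add_zero] at this
    exact (mul_eq_zero.1 this).resolve_right hne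

theorem hasFinitePart_of_tendsto_zero {f : ℝ → ℂ} (h : Tendsto f atTop (𝓝 0)) :
    HasFinitePart f 0 :=
  ⟨∅, 0, 0, by simp, by simpa using h⟩

theorem HasFinitePart.congr' {f g : ℝ → ℂ} {c : ℂ} (hf : HasFinitePart f c)
    (h : f =ᶠ[atTop] g) : HasFinitePart g c := by
  obtain ⟨s, a, b, h0, ht⟩ := hf
  exact ⟨s, a, b, h0, ht.congr' (h.mono fun R hR => by simp only [hR])⟩

theorem hasFinitePart_mul_cpow (a z : ℂ) :
    HasFinitePart (fun R => a * (R : ℂ) ^ z) (if z = 0 then a else 0) := by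
  split_ifs with hz
  · subst hz
    exact ⟨∅, 0, 0, by simp, by simp⟩
  · exact ⟨{z}, fun _ => a, 0, by simpa using Ne.symm hz, by simp⟩

theorem HasFinitePart.linear {f g : ℝ → ℂ} {c e : ℂ} (t : ℂ) (hf : HasFinitePart f c)
    (hg : HasFinitePart g e) : HasFinitePart (fun R => f R + t * g R) (c + t * e) := by
  classical
  obtain ⟨s, a, b, h0, ht⟩ := hf
  obtain ⟨s', a', b', h0', ht'⟩ := hg
  refine ⟨s ∪ s', fun z => (if z ∈ s then a z else 0) + t * (if z ∈ s' then a' z else 0), b + t * b',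
    by simp [h0, h0'], ?_⟩
  have h := ht.add (ht'.const_mul t)
  rw [mul_zero, add_zero] at h
  refine h.congr fun R => ?_
  have e1 : ∑ z ∈ s ∪ s', ((if z ∈ s then a z else 0) + t * (if z ∈ s' then a' z else 0)) *
      (R : ℂ) ^ z = ∑ z ∈ s, a z * (R : ℂ) ^ z + t * ∑ z ∈ s', a' z * (R : ℂ) ^ z := by
    simp only [add_mul, Finset.sum_add_distrib, mul_assoc, ← Finset.mul_sum, ite_mul, zero_mul]
    rw [← Finset.sum_filter, ← Finset.sum_filter, Finset.filter_mem_eq_inter,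
      Finset.filter_mem_eq_inter, Finset.union_inter_cancel_left, Finset.union_inter_cancel_right]
  rw [e1]
  ring

theorem HasFinitePart.add {f g : ℝ → ℂ} {c e : ℂ} (hf : HasFinitePart f c)
    (hg : HasFinitePart g e) : HasFinitePart (fun R => f R + g R) (c + e) := by
  simpa using hf.linear 1 hg

theorem HasFinitePart.unique {f : ℝ → ℂ} {c e : ℂ} (hf : HasFinitePart f c)
    (hg : HasFinitePart f e) : c = e := by
  obtain ⟨s, a, b, h0, ht⟩ := hf.linear (-1) hg
  have h : Tendsto (fun R : ℝ => (c + -1 * e) + ∑ z ∈ s, a z * (R : ℂ) ^ z + b * (Real.log R : ℂ))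
      atTop (𝓝 0) := by
    simpa using ht.neg
  have := (coeff_eq_zero_of_tendsto_zero s a b _ h0 h).1
  linear_combination this

theorem HasFinitePart.finitePart_eq {f : ℝ → ℂ} {c : ℂ} (hf : HasFinitePart f c) :
    finitePart f = c := by
  have h : ∃ c, HasFinitePart f c := ⟨c, hf⟩
  rw [finitePart, dif_pos h]
  exact h.choose_spec.unique hf

theorem HasFinitePart.sum {ι : Type*} (s : Finset ι) {f : ι → ℝ → ℂ} {c : ι → ℂ}
    (h : ∀ k ∈ s, HasFinitePart (f k) (c k)) :
    HasFinitePart (fun R => ∑ k ∈ s, f k R) (∑ k ∈ s, c k) := by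
  classical
  induction s using Finset.induction_on with
  | empty => simpa using hasFinitePart_of_tendsto_zero tendsto_const_nhds
  | insert k s hk ih =>
    simp only [Finset.sum_insert hk]
    exact (h k (s.mem_insert_self k)).add (ih fun j hj => h j (Finset.mem_insert_of_mem hj))

/-! ### The divergence theorem on balls -/

section Divergence

open Module Metric

variable {E F : Type*} [NormedAddCommGroup F] [NormedSpace ℝ F]

theorem norm_smul_sphere [NormedAddCommGroup E] [NormedSpace ℝ E] {r : ℝ} (hr : 0 < r)
    (θ : sphere (0 : E) 1) : ‖r • (θ : E)‖ = r := by
  rw [norm_smul, norm_eq_of_mem_sphere, mul_one, Real.norm_of_nonneg hr.le]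

/-- Integration in polar coordinates for functions that need not be radial. -/
theorem integral_eq_integral_Ioi_toSphere [NormedAddCommGroup E] [NormedSpace ℝ E]
    [FiniteDimensional ℝ E] [Nontrivial E] [MeasurableSpace E] [BorelSpace E] (μ : Measure E)
    [μ.IsAddHaarMeasure] {u : E → F} (hu : Integrable u μ) :
    ∫ ξ, u ξ ∂μ = ∫ r in Ioi (0 : ℝ), r ^ (finrank ℝ E - 1) •
      ∫ θ : sphere (0 : E) 1, u (r • (θ : E)) ∂μ.toSphere := by
  have hmp := μ.measurePreserving_homeomorphUnitSphereProd
  have hemb := (homeomorphUnitSphereProd E).measurableEmbedding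
  set w : sphere (0 : E) 1 × Ioi (0 : ℝ) → F := fun p => u ((p.2 : ℝ) • (p.1 : E)) with hw
  have hcomp : w ∘ homeomorphUnitSphereProd E = fun x : ({0}ᶜ : Set E) => u x := by
    funext x
    have hx : ‖(x : E)‖ ≠ 0 := norm_ne_zero_iff.2 x.2
    simp [hw, smul_smul, mul_inv_cancel₀ hx]
  have hint : Integrable w (μ.toSphere.prod (.volumeIoiPow (finrank ℝ E - 1))) := by
    rw [← hmp.integrable_comp_emb hemb, hcomp]
    have := hu.integrableOn (s := ({0}ᶜ : Set E))
    rwa [integrableOn_iff_comap_subtypeVal (measurableSet_singleton _).compl] at this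
  calc
    ∫ ξ, u ξ ∂μ = ∫ x : ({0}ᶜ : Set E), u x ∂(μ.comap (↑)) := by
      rw [integral_subtype_comap (measurableSet_singleton _).compl u, restrict_compl_singleton]
    _ = ∫ p, w p ∂μ.toSphere.prod (.volumeIoiPow (finrank ℝ E - 1)) := by
      rw [← hmp.integral_comp hemb w]
      exact integral_congr_ae (.of_forall fun x => (congrFun hcomp x).symm)
    _ = ∫ r : Ioi (0 : ℝ), ∫ θ : sphere (0 : E) 1, u ((r : ℝ) • (θ : E)) ∂μ.toSphere
          ∂.volumeIoiPow (finrank ℝ E - 1) := integral_prod_symm _ hint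
    _ = _ := by
      simp only [Measure.volumeIoiPow, ENNReal.ofReal]
      rw [integral_withDensity_eq_integral_smul,
        integral_subtype_comap measurableSet_Ioi fun a : ℝ ↦
          Real.toNNReal (a ^ (finrank ℝ E - 1)) •
            ∫ θ : sphere (0 : E) 1, u (a • (θ : E)) ∂μ.toSphere,
        setIntegral_congr_fun measurableSet_Ioi fun x hx ↦ ?_]
      · simp only [NNReal.smul_def, Real.coe_toNNReal _ (pow_nonneg hx.out.le _)]
      · exact (measurable_subtype_coe.pow_const _).real_toNNReal

variable [NormedAddCommGroup E] [InnerProductSpace ℝ E]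

/-- A function `φ` of the norm is differentiable, also at the origin if `φ' 0 = 0`. (The derivative
is written with the junk value `ψ 0 / 0 = 0` there.) -/
theorem hasFDerivAt_comp_norm {φ ψ : ℝ → ℝ} (hφ : ∀ s, HasDerivAt φ (ψ s) s) (h0 : ψ 0 = 0)
    (ξ : E) : HasFDerivAt (fun ξ : E => φ ‖ξ‖) ((ψ ‖ξ‖ / ‖ξ‖) • innerSL ℝ ξ) ξ := by
  rcases eq_or_ne ξ 0 with rfl | hξ
  · have h1 := hφ 0
    rw [h0, hasDerivAt_iff_isLittleO] at h1
    simp only [norm_zero, h0, zero_div, zero_smul]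
    rw [hasFDerivAt_iff_isLittleO]
    have hn : Tendsto (fun ξ : E => ‖ξ‖) (𝓝 0) (𝓝 0) := by
      simpa using (continuous_norm.tendsto (0 : E))
    have h2 := h1.comp_tendsto hn
    rw [← Asymptotics.isLittleO_norm_right]
    simpa [Function.comp_def] using h2
  · have hn : ‖ξ‖ ≠ 0 := norm_ne_zero_iff.2 hξ
    have h1 := (hasStrictFDerivAt_norm_sq ξ).hasFDerivAt.sqrt (by positivity)
    simp only [Real.sqrt_sq (norm_nonneg _)] at h1
    have h2 := (hφ ‖ξ‖).comp_hasFDerivAt ξ h1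
    refine h2.congr_fderiv ?_
    ext v
    simp
    field_simp

variable [FiniteDimensional ℝ E] [MeasurableSpace E] [BorelSpace E]

theorem continuous_integral_sphere (μ : Measure E) [μ.IsAddHaarMeasure] {G : Type*}
    [NormedAddCommGroup G] [NormedSpace ℝ G] {u : ℝ → sphere (0 : E) 1 → G}
    (hu : Continuous (Function.uncurry u)) :
    Continuous fun r => ∫ θ, u r θ ∂μ.toSphere := by
  rw [← continuousOn_univ]
  exact continuousOn_integral_of_compact_support isCompact_univ hu.continuousOn (by simp)

variable [Nontrivial E] [CompleteSpace F]

/-- The radially tested form of the divergence theorem on balls. -/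
theorem integral_smul_radial_sub_flux_eq_zero (μ : Measure E) [μ.IsAddHaarMeasure] {g : E → F}
    (hg : ContDiff ℝ 1 g) (v : E) {ψ : ℝ → ℝ} (hψ : Continuous ψ) (hψc : HasCompactSupport ψ)
    (hψ0 : tsupport ψ ⊆ Ioi 0) :
    ∫ r, ψ r • ((∫ s in (0 : ℝ)..r, s ^ (finrank ℝ E - 1) •
        ∫ θ : sphere (0 : E) 1, fderiv ℝ g (s • (θ : E)) v ∂μ.toSphere) -
      r ^ (finrank ℝ E - 1) • ∫ θ : sphere (0 : E) 1,
        inner ℝ (θ : E) v • g (r • (θ : E)) ∂μ.toSphere) = 0 := by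
  set n := finrank ℝ E - 1
  have hDg : Continuous fun ξ => fderiv ℝ g ξ v :=
    (hg.continuous_fderiv one_ne_zero).clm_apply continuous_const
  set b : ℝ → F := fun s => s ^ n • ∫ θ : sphere (0 : E) 1, fderiv ℝ g (s • (θ : E)) v ∂μ.toSphere
    with hb
  set a : ℝ → F := fun r => r ^ n • ∫ θ : sphere (0 : E) 1, inner ℝ (θ : E) v • g (r • (θ : E))
    ∂μ.toSphere with ha
  have hbc : Continuous b := (continuous_pow n).smul <| continuous_integral_sphere μ <|
    hDg.comp (by fun_prop)
  have hac : Continuous a := (continuous_pow n).smul <| continuous_integral_sphere μ <| by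
    have := hg.continuous
    simp only [Function.uncurry_def]
    fun_prop
  have hψneg : ∀ s ≤ 0, ψ s = 0 := fun s hs =>
    image_eq_zero_of_notMem_tsupport fun h => absurd (hψ0 h) (not_lt.2 hs)
  obtain ⟨M, hM0, hM⟩ : ∃ M : ℝ, 0 < M ∧ ∀ s, M ≤ s → ψ s = 0 := by
    obtain ⟨C, hC⟩ := hψc.isCompact.isBounded.bddAbove
    refine ⟨max C 0 + 1, by positivity, fun s hs => image_eq_zero_of_notMem_tsupport fun h => ?_⟩
    linarith [hC h, le_max_left C 0]
  have hsupp : ∀ f : ℝ → F, ∫ r, ψ r • f r = ∫ r in (0 : ℝ)..M, ψ r • f r := by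
    intro f
    refine (intervalIntegral.integral_eq_integral_of_support_subset fun s hs => ?_).symm
    have hs' : ψ s ≠ 0 := fun h => hs (by simp [h])
    exact ⟨not_le.1 fun h => hs' (hψneg s h), (not_le.1 fun h => hs' (hM s h)).le⟩
  -- The radial test function is the primitive of `-ψ` that vanishes for large arguments.
  set φ : ℝ → ℝ := fun s => ∫ t in s..M, ψ t with hφdef
  have hφ : ∀ s, HasDerivAt φ (-ψ s) s := fun s =>
    intervalIntegral.integral_hasDerivAt_left (hψ.intervalIntegrable _ _)
      (hψ.stronglyMeasurableAtFilter _ _) hψ.continuousAt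
  have hφc : Continuous φ := continuous_iff_continuousAt.2 fun s => (hφ s).continuousAt
  have hφM : ∀ s, M ≤ s → φ s = 0 := fun s hs => by
    simp only [hφdef]
    rw [intervalIntegral.integral_congr (g := fun _ => (0 : ℝ)) fun t ht => ?_]
    · simp
    · rw [uIcc_of_ge hs] at ht
      exact hM t ht.1
  have hIoi : ∀ f : ℝ → F, (∀ s, M < s → f s = 0) →
      ∫ r in Ioi (0 : ℝ), f r = ∫ r in (0 : ℝ)..M, f r := by
    intro f hf
    rw [intervalIntegral.integral_of_le hM0.le]
    refine setIntegral_eq_of_subset_of_forall_sdiff_eq_zero measurableSet_Ioi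
      (fun s hs => hs.1) fun s hs => hf s ?_
    exact not_le.1 fun h => hs.2 ⟨hs.1, h⟩
  have hfd := hasFDerivAt_comp_norm (E := E) hφ (by simp [hψneg 0 le_rfl])
  have hcs : ∀ {G : Type _} [NormedAddCommGroup G] (f : E → G), (∀ ξ : E, M ≤ ‖ξ‖ → f ξ = 0) →
      HasCompactSupport f := by
    intro G _ f hf
    refine HasCompactSupport.intro (isCompact_closedBall (0 : E) M) fun ξ hξ => hf ξ ?_
    rw [mem_closedBall_zero_iff, not_le] at hξ
    exact hξ.le
  have hint1 : Integrable (fun ξ : E => φ ‖ξ‖ • fderiv ℝ g ξ v) μ :=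
    Continuous.integrable_of_hasCompactSupport (by fun_prop)
      (hcs _ fun ξ hξ => by simp [hφM _ hξ])
  have hint2 : Integrable (fun ξ : E => φ ‖ξ‖ • g ξ) μ :=
    Continuous.integrable_of_hasCompactSupport (by have := hg.continuous; fun_prop)
      (hcs _ fun ξ hξ => by simp [hφM _ hξ])
  have hint3 : Integrable (fun ξ : E => (inner ℝ ξ v / ‖ξ‖) • (ψ ‖ξ‖ • g ξ)) μ := by
    have h1 : Integrable (fun ξ : E => ψ ‖ξ‖ • g ξ) μ :=
      Continuous.integrable_of_hasCompactSupport (by have := hg.continuous; fun_prop)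
        (hcs _ fun ξ hξ => by simp [hM _ hξ])
    refine h1.bdd_smul (C := ‖v‖) ?_ (.of_forall fun ξ => ?_)
    · exact ((Continuous.inner continuous_id continuous_const).measurable.div
        measurable_norm).aestronglyMeasurable
    · rw [norm_div, norm_norm]
      refine div_le_of_le_mul₀ (norm_nonneg _) (norm_nonneg _) ?_
      rw [mul_comm]
      exact norm_inner_le_norm ξ v
  have hfd' : ∀ ξ : E, fderiv ℝ (fun ξ : E => φ ‖ξ‖) ξ v • g ξ =
      -((inner ℝ ξ v / ‖ξ‖) • (ψ ‖ξ‖ • g ξ)) := fun ξ => by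
    rw [(hfd ξ).fderiv, smul_smul, ← neg_smul]
    congr 1
    simp
    ring
  have hparts := integral_smul_fderiv_eq_neg_fderiv_smul_of_integrable (μ := μ) (v := v)
    (f := fun ξ : E => φ ‖ξ‖) (g := g) ((integrable_congr (.of_forall hfd')).2 hint3.neg) hint1 hint2
    (fun ξ _ => (hfd ξ).differentiableAt) (fun ξ _ => hg.differentiable one_ne_zero ξ)
  simp only [hfd', integral_neg, neg_neg] at hparts
  have hL : ∫ ξ : E, φ ‖ξ‖ • fderiv ℝ g ξ v ∂μ = ∫ r in (0 : ℝ)..M, φ r • b r := by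
    rw [integral_eq_integral_Ioi_toSphere μ hint1, ← hIoi _ fun s hs => by simp [hφM s hs.le]]
    refine setIntegral_congr_fun measurableSet_Ioi fun r hr => ?_
    simp only [norm_smul_sphere hr, integral_smul, hb]
    rw [smul_comm]
  have hR : ∫ ξ : E, (inner ℝ ξ v / ‖ξ‖) • (ψ ‖ξ‖ • g ξ) ∂μ = ∫ r in (0 : ℝ)..M, ψ r • a r := by
    rw [integral_eq_integral_Ioi_toSphere μ hint3, ← hIoi _ fun s hs => by simp [hM s hs.le]]
    refine setIntegral_congr_fun measurableSet_Ioi fun r hr => ?_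
    have hr' : r ≠ 0 := (mem_Ioi.1 hr).ne'
    simp only [norm_smul_sphere hr, inner_smul_left, ha, RCLike.conj_to_real, mul_div_cancel_left₀ _ hr']
    simp only [smul_comm _ (ψ r), integral_smul]
    rw [smul_comm]
  have hFd : ∀ r, HasDerivAt (fun r => ∫ s in (0 : ℝ)..r, b s) (b r) r := fun r =>
    intervalIntegral.integral_hasDerivAt_right (hbc.intervalIntegrable _ _)
      (hbc.stronglyMeasurableAtFilter _ _) hbc.continuousAt
  have hFc : Continuous (fun r => ∫ s in (0 : ℝ)..r, b s) :=
    continuous_iff_continuousAt.2 fun s => (hFd s).continuousAt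
  have hibp : ∫ r in (0 : ℝ)..M, φ r • b r = ∫ r in (0 : ℝ)..M, ψ r • ∫ s in (0 : ℝ)..r, b s := by
    rw [intervalIntegral.integral_smul_deriv_eq_deriv_smul (fun r _ => hφ r) (fun r _ => hFd r)
      (hψ.neg.intervalIntegrable _ _) (hbc.intervalIntegrable _ _)]
    simp [hφM M le_rfl]
  rw [hsupp]
  change ∫ r in (0 : ℝ)..M, ψ r • ((∫ s in (0 : ℝ)..r, b s) - a r) = 0
  have hsub := intervalIntegral.integral_sub (μ := volume) (a := 0) (b := M)
    ((hψ.smul hFc).intervalIntegrable _ _) ((hψ.smul hac).intervalIntegrable _ _)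
  simp only [Pi.smul_apply', ← smul_sub] at hsub
  rw [hsub, ← hibp, ← hL, hparts, hR, sub_self]

/-- The divergence theorem on a ball centred at the origin, for the vector field `g v`. -/
theorem setIntegral_ball_fderiv (μ : Measure E) [μ.IsAddHaarMeasure] {g : E → F}
    (hg : ContDiff ℝ 1 g) (v : E) {R : ℝ} (hR : 0 < R) :
    ∫ ξ in ball (0 : E) R, fderiv ℝ g ξ v ∂μ = R ^ (finrank ℝ E - 1) •
      ∫ θ : sphere (0 : E) 1, inner ℝ (θ : E) v • g (R • (θ : E)) ∂μ.toSphere := by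
  set n := finrank ℝ E - 1
  have hDg : Continuous fun ξ => fderiv ℝ g ξ v :=
    (hg.continuous_fderiv one_ne_zero).clm_apply continuous_const
  set b : ℝ → F := fun s => s ^ n • ∫ θ : sphere (0 : E) 1, fderiv ℝ g (s • (θ : E)) v ∂μ.toSphere
    with hb
  set a : ℝ → F := fun r => r ^ n • ∫ θ : sphere (0 : E) 1, inner ℝ (θ : E) v • g (r • (θ : E))
    ∂μ.toSphere with ha
  have hbc : Continuous b := (continuous_pow n).smul <| continuous_integral_sphere μ <|
    hDg.comp (by fun_prop)
  have hac : Continuous a := (continuous_pow n).smul <| continuous_integral_sphere μ <| by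
    have := hg.continuous
    simp only [Function.uncurry_def]
    fun_prop
  have hFc : Continuous (fun r => ∫ s in (0 : ℝ)..r, b s) :=
    intervalIntegral.continuous_primitive (fun _ _ => hbc.intervalIntegrable _ _) 0
  have hball : ∫ ξ in ball (0 : E) R, fderiv ℝ g ξ v ∂μ = ∫ s in (0 : ℝ)..R, b s := by
    have hi : Integrable ((ball (0 : E) R).indicator fun ξ => fderiv ℝ g ξ v) μ :=
      (integrable_indicator_iff measurableSet_ball).2
        ((hDg.continuousOn.integrableOn_compact (isCompact_closedBall 0 R)).mono_set
          ball_subset_closedBall)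
    rw [← integral_indicator measurableSet_ball, integral_eq_integral_Ioi_toSphere μ hi,
      intervalIntegral.integral_of_le hR.le, integral_Ioc_eq_integral_Ioo,
      setIntegral_eq_of_subset_of_forall_sdiff_eq_zero (t := Ioi (0 : ℝ)) (s := Ioo 0 R)
        measurableSet_Ioi (fun s hs => hs.1) fun s hs => ?_]
    · refine setIntegral_congr_fun measurableSet_Ioo fun s hs => ?_
      have : ∀ θ : sphere (0 : E) 1, s • (θ : E) ∈ ball (0 : E) R := fun θ => by
        rw [mem_ball_zero_iff, norm_smul_sphere hs.1]
        exact hs.2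
      simp only [indicator_of_mem (this _), hb]
      rfl
    · have h0 : 0 < s := hs.1
      have : ∀ θ : sphere (0 : E) 1, s • (θ : E) ∉ ball (0 : E) R := fun θ => by
        rw [mem_ball_zero_iff, norm_smul_sphere h0]
        exact fun h => hs.2 ⟨h0, h⟩
      simp only [indicator_of_notMem (this _), integral_zero, smul_zero]
  have hae := isOpen_Ioi.ae_eq_zero_of_integral_contDiff_smul_eq_zero (μ := volume)
    (U := Ioi (0 : ℝ)) ((hFc.sub hac).locallyIntegrable.locallyIntegrableOn _)
    fun ψ h1 h2 h3 => integral_smul_radial_sub_flux_eq_zero μ hg v h1.continuous h2 h3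
  have heq := Measure.eqOn_open_of_ae_eq (μ := volume) (U := Ioi (0 : ℝ))
    (f := fun r => (∫ s in (0 : ℝ)..r, b s) - a r) (g := fun _ => 0)
    ((ae_restrict_iff' measurableSet_Ioi).2 hae) isOpen_Ioi (hFc.sub hac).continuousOn
    continuousOn_const hR
  rw [hball]
  exact sub_eq_zero.1 heq

end Divergence

/-! ### Forms on the unit sphere -/

/-- Cramer's rule for an orthogonal matrix: a cofactor is the entry times the determinant. -/
theorem det_mul_cofactor_of_mem_orthogonalGroup {d : ℕ} {A : Matrix (Fin (d + 1)) (Fin (d + 1)) ℝ}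
    (hA : A ∈ Matrix.orthogonalGroup (Fin (d + 1)) ℝ) (i : Fin (d + 1)) :
    A.det * (A.submatrix Fin.succ i.succAbove).det = (-1) ^ (i : ℕ) * A 0 i := by
  have hAA : A * A.transpose = 1 := (Matrix.mem_orthogonalGroup_iff _ _).1 hA
  have hdet : A.det * A.det = 1 := by
    have := congrArg Matrix.det hAA
    rwa [Matrix.det_mul, Matrix.det_transpose, Matrix.det_one] at this
  have hadj : A.adjugate = A.det • A.transpose := by
    calc A.adjugate = A.adjugate * (A * A.transpose) := by rw [hAA, mul_one]
      _ = A.det • A.transpose := by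
        rw [← mul_assoc, Matrix.adjugate_mul, Matrix.smul_mul, one_mul]
  have h := congrFun (congrFun hadj i) 0
  rw [Matrix.adjugate_fin_succ_eq_det_submatrix, Matrix.smul_apply, Matrix.transpose_apply,
    smul_eq_mul, Fin.val_zero, zero_add] at h
  have hs : A.submatrix (Fin.succAbove 0) i.succAbove = A.submatrix Fin.succ i.succAbove := by
    rw [Fin.succAbove_zero]
  rw [hs] at h
  have hsign : ((-1 : ℝ) ^ (i : ℕ)) * (-1) ^ (i : ℕ) = 1 := by
    rw [← mul_pow]; simp
  linear_combination (A.det * (-1) ^ (i : ℕ)) * h + (-1) ^ (i : ℕ) * A 0 i * hdet -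
    A.det * (A.submatrix Fin.succ i.succAbove).det * hsign

theorem frame_mem_orthogonalGroup {d : ℕ} (ξ : Metric.sphere (0 : V (d + 1)) 1) :
    (Matrix.of fun j k => frame ξ j k) ∈ Matrix.orthogonalGroup (Fin (d + 1)) ℝ := by
  rw [Matrix.mem_orthogonalGroup_iff]
  ext j k
  have h := orthonormal_iff_ite.1 (frame ξ).orthonormal j k
  rw [Matrix.one_apply, ← h, Matrix.mul_apply, PiLp.inner_apply]
  exact Finset.sum_congr rfl fun l _ => by simp [mul_comm]

/-- The contraction of the volume form with the outer normal: on the unit sphere,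
`dξ_1 ∧ ⋯ ∧ dξ_n` with `dξ_i` omitted is `(-1)^(i-1) ξ_i` times the surface element. -/
theorem det_frame_mul_dxiHat {d : ℕ} (i : Fin (d + 1)) (ξ : Metric.sphere (0 : V (d + 1)) 1) :
    (Matrix.of fun j k => frame ξ j k).det * dxiHat i (fun j => frame ξ j.succ) =
      (-1) ^ (i : ℕ) * (ξ : V (d + 1)) i := by
  have h := det_mul_cofactor_of_mem_orthogonalGroup (frame_mem_orthogonalGroup ξ) i
  have h0 : frame ξ 0 = ξ := (exists_frame ξ).choose_spec
  rw [Matrix.of_apply, h0] at h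
  exact h

/-- The flux `∫ h(x, θ) θ_i dθ` through the unit cosphere at `x` of the field `h(x, ·)` in the `i`-th
coordinate direction. -/
noncomputable def sphereFlux {d : ℕ} (h : V (d + 1) → V (d + 1) → ℂ) (i : Fin (d + 1))
    (x : V (d + 1)) : ℂ :=
  ∫ θ : Metric.sphere (0 : V (d + 1)) 1, h x θ * (((θ : V (d + 1)) i : ℝ) : ℂ)
    ∂(volume : Measure (V (d + 1))).toSphere

theorem fibreCosphere_eq {d : ℕ} (h : V (d + 1) → V (d + 1) → ℂ) (i : Fin (d + 1))
    (x : V (d + 1)) : fibreCosphere h i x = (-1) ^ (i : ℕ) * sphereFlux h i x := by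
  rw [fibreCosphere, sphereFormIntegral, sphereFlux, ← integral_const_mul]
  refine integral_congr_ae (.of_forall fun θ => ?_)
  have e : (smulDxiHat (h x) i (θ : V (d + 1))) (fun j => frame θ j.succ) =
      h x θ * ((dxiHat i (fun j => frame θ j.succ) : ℝ) : ℂ) := rfl
  have hc := congrArg (fun t : ℝ => (t : ℂ)) (det_frame_mul_dxiHat i θ)
  simp only [Complex.ofReal_mul, Complex.ofReal_pow, Complex.ofReal_neg, Complex.ofReal_one] at hc
  simp only [e]
  linear_combination (h x θ) * hc

/-! ### Scaling and decomposing symbols -/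

theorem partialX_const_smul {n : ℕ} (i : Fin n) (t : ℂ) (σ : V n → V n → ℂ) :
    partialX i (t • σ) = t • partialX i σ := by
  funext x ξ
  have h := congrFun (fderiv_const_smul_field (𝕜 := ℝ) (f := fun y => σ y ξ) t) x
  exact congrArg (fun L : V n →L[ℝ] ℂ => L (basisVec i)) h

theorem partialXi_const_smul {n : ℕ} (i : Fin n) (t : ℂ) (σ : V n → V n → ℂ) :
    partialXi i (t • σ) = t • partialXi i σ := by
  funext x ξ
  have h := congrFun (fderiv_const_smul_field (𝕜 := ℝ) (f := σ x) t) ξ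
  exact congrArg (fun L : V n →L[ℝ] ℂ => L (basisVec i)) h

theorem mixedDeriv_const_smul {n : ℕ} (α β : List (Fin n)) (t : ℂ) (σ : V n → V n → ℂ) :
    mixedDeriv α β (t • σ) = t • mixedDeriv α β σ := by
  have hβ : β.foldr partialXi (t • σ) = t • β.foldr partialXi σ := by
    induction β with
    | nil => rfl
    | cons i β ih => rw [List.foldr_cons, List.foldr_cons, ih, partialXi_const_smul]
  rw [mixedDeriv, mixedDeriv, hβ]
  induction α with
  | nil => rfl
  | cons i α ih => rw [List.foldr_cons, List.foldr_cons, ih, partialX_const_smul]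

theorem IsSymbol.const_smul {n : ℕ} {U : Set (V n)} {r : ℝ} {σ : V n → V n → ℂ}
    (h : IsSymbol U r σ) (t : ℂ) : IsSymbol U r (t • σ) where
  smooth := h.smooth.const_smul t
  bound K hK hKU α β := by
    obtain ⟨C, hC⟩ := h.bound K hK hKU α β
    refine ⟨‖t‖ * C, fun x hx ξ => ?_⟩
    rw [mixedDeriv_const_smul, Pi.smul_apply, Pi.smul_apply, norm_smul, mul_assoc]
    exact mul_le_mul_of_nonneg_left (hC x hx ξ) (norm_nonneg t)

theorem IsClassicalExpansion.const_smul {n : ℕ} {U : Set (V n)} {m : ℂ} {σ : V n → V n → ℂ}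
    {c : ℕ → V n → V n → ℂ} (h : IsClassicalExpansion U m σ c) (t : ℂ) :
    IsClassicalExpansion U m (t • σ) (t • c) where
  symbol := h.symbol.const_smul t
  homogeneous j :=
    { smooth := (h.homogeneous j).smooth.const_smul t
      homogeneous := fun x hx ξ hξ s hs => by
        simp only [Pi.smul_apply, smul_eq_mul, (h.homogeneous j).homogeneous x hx ξ hξ s hs]
        ring }
  remainder := by
    obtain ⟨χ, hχ, hr⟩ := h.remainder
    refine ⟨χ, hχ, fun N => ?_⟩
    convert (hr N).const_smul t using 1
    funext x ξ
    simp only [Pi.smul_apply, smul_eq_mul, mul_sub, Finset.mul_sum]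
    congr 1
    exact Finset.sum_congr rfl fun j _ => by ring

/-- An element of the span of the compactly supported classical symbols with orders in `S` is a sum
of such symbols: the scalars are absorbed into the symbols. -/
theorem exists_decomposition_of_mem_span {n : ℕ} {U : Set (V n)} {S : Set ℂ}
    {σ : V n → V n → ℂ} (hσ : σ ∈ Submodule.span ℂ (⋃ m ∈ S, CScomOrder U m)) :
    ∃ (p : ℕ) (m : Fin p → ℂ) (τ : Fin p → V n → V n → ℂ) (c : Fin p → ℕ → V n → V n → ℂ),
      (∀ k, m k ∈ S) ∧ (∀ k, IsClassicalExpansion U (m k) (τ k) (c k)) ∧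
      (∀ k, HasCompactSupportIn U (τ k)) ∧ σ = ∑ k, τ k := by
  obtain ⟨p, t, g, rfl⟩ := Submodule.mem_span_set'.1 hσ
  have hg : ∀ k, ∃ m ∈ S, (g k : V n → V n → ℂ) ∈ CScomOrder U m := fun k => by
    simpa only [mem_iUnion, exists_prop] using (g k).2
  choose m hmS hm using hg
  choose c hc using fun k => (hm k).1
  refine ⟨p, m, fun k => t k • (g k : V n → V n → ℂ), fun k => t k • c k, hmS,
    fun k => (hc k).const_smul (t k), fun k => ?_, rfl⟩
  obtain ⟨K, hK, hKU, h0⟩ := (hm k).2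
  exact ⟨K, hK, hKU, fun x hx hxK ξ => by simp [h0 x hx hxK ξ]⟩

theorem exists_isHomComponent {n : ℕ} {U : Set (V n)} {σ : V n → V n → ℂ} (hσ : σ ∈ CScom U)
    (a : ℂ) : ∃ h, IsHomComponent U σ a h := by
  have hσ' : σ ∈ Submodule.span ℂ (⋃ m ∈ (univ : Set ℂ), CScomOrder U m) := by
    simpa [CScom] using hσ
  obtain ⟨p, m, τ, c, -, hc, hK, rfl⟩ := exists_decomposition_of_mem_span hσ'
  exact ⟨_, p, m, τ, c, hc, hK, fun x _ ξ => by simp, fun x _ ξ _ => rfl⟩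

/-- Sums of symbols of non-integer orders have no components of integer degree. -/
theorem isHomComponent_zero_of_mem_CScomNonInt {n : ℕ} {U : Set (V n)} {σ : V n → V n → ℂ}
    (hσ : σ ∈ CScomNonInt U) (a : ℤ) : IsHomComponent U σ a 0 := by
  obtain ⟨p, m, τ, c, hm, hc, hK, rfl⟩ := exists_decomposition_of_mem_span hσ
  refine ⟨p, m, τ, c, hc, hK, fun x _ ξ => by simp, fun x _ ξ _ => ?_⟩
  have hne : ∀ (k : Fin p) (j : ℕ), m k - (j : ℂ) ≠ a := fun k j h =>
    hm k (a + j) (by push_cast; linear_combination h)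
  simp [hne]

/-- At most one `j` contributes to a component of given degree. -/
theorem finsum_degree_eq (m a : ℂ) :
    (∃ j₀ : ℕ, m - (j₀ : ℂ) = a ∧ ∀ f : ℕ → ℂ, ∑ᶠ (j : ℕ) (_ : m - (j : ℂ) = a), f j = f j₀) ∨
      ((∀ j : ℕ, m - (j : ℂ) ≠ a) ∧ ∀ f : ℕ → ℂ, ∑ᶠ (j : ℕ) (_ : m - (j : ℂ) = a), f j = 0) := by
  by_cases h : ∃ j₀ : ℕ, m - (j₀ : ℂ) = a
  · obtain ⟨j₀, h₀⟩ := h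
    refine .inl ⟨j₀, h₀, fun f => ?_⟩
    have hiff : ∀ j : ℕ, m - (j : ℂ) = a ↔ j = j₀ := fun j => by
      rw [← h₀, sub_right_inj, Nat.cast_inj]
    simp only [hiff, finsum_cond_eq_left]
  · push Not at h
    exact .inr ⟨h, fun f => by simp [h]⟩

/-! ### The asymptotic expansion of the flux through large spheres -/

theorem sphere_ne_zero {n : ℕ} (θ : Metric.sphere (0 : V n) 1) : (θ : V n) ≠ 0 :=
  Metric.ne_of_mem_sphere θ.2 one_ne_zero

theorem continuousOn_sphereFlux {d : ℕ} {U : Set (V (d + 1))} {h : V (d + 1) → V (d + 1) → ℂ}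
    (hh : ContinuousOn (Function.uncurry h) (U ×ˢ {0}ᶜ)) (i : Fin (d + 1)) :
    ContinuousOn (sphereFlux h i) U := by
  refine continuousOn_integral_of_compact_support isCompact_univ ?_ (by simp)
  refine ContinuousOn.mul ?_ (by fun_prop)
  exact hh.comp (f := fun p : V (d + 1) × Metric.sphere (0 : V (d + 1)) 1 =>
    (p.1, (p.2 : V (d + 1)))) (by fun_prop) fun p hp => ⟨hp.1, sphere_ne_zero p.2⟩

theorem integrable_of_continuous_sphere {n : ℕ} {f : Metric.sphere (0 : V n) 1 → ℂ}
    (hf : Continuous f) : Integrable f (volume : Measure (V n)).toSphere :=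
  hf.integrable_of_hasCompactSupport (HasCompactSupport.of_compactSpace f)

/-- The flux of a classical symbol through the sphere of radius `R` is, up to `o(1)`, a sum of
multiples of `R ^ (m - j + d)`; the exponent `0` belongs to the component of degree `-d`. -/
theorem IsClassicalExpansion.hasFinitePart_flux {d : ℕ} {U : Set (V (d + 1))} {m : ℂ}
    {τ : V (d + 1) → V (d + 1) → ℂ} {c : ℕ → V (d + 1) → V (d + 1) → ℂ}
    (hτ : IsClassicalExpansion U m τ c) (i : Fin (d + 1)) {x : V (d + 1)} (hx : x ∈ U) :
    HasFinitePart (fun R => (R : ℂ) ^ d * sphereFlux (fun x ξ => τ x (R • ξ)) i x)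
      (sphereFlux (fun x ξ => ∑ᶠ (j : ℕ) (_ : m - (j : ℂ) = -(d : ℂ)), c j x ξ) i x) := by
  obtain ⟨χ, hχ, hrem⟩ := hτ.remainder
  obtain ⟨N, hN⟩ := exists_nat_gt (m.re + d)
  obtain ⟨C, hC⟩ := (hrem N).bound {x} isCompact_singleton (singleton_subset_iff.2 hx) [] []
  set p : ℝ := m.re - N - 1 with hp
  have hbound : ∀ ξ : V (d + 1),
      ‖τ x ξ - ∑ j ∈ Finset.range (N + 1), (χ x ξ : ℂ) * c j x ξ‖ ≤ C * (1 + ‖ξ‖) ^ p :=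
    fun ξ => by simpa [mixedDeriv] using hC x rfl ξ
  have hτc : Continuous (τ x) := by
    rw [← continuousOn_univ]
    exact hτ.symbol.smooth.continuousOn.comp (f := fun ξ => (x, ξ)) (by fun_prop)
      fun ξ _ => ⟨hx, mem_univ ξ⟩
  have hcc : ∀ j, Continuous fun θ : Metric.sphere (0 : V (d + 1)) 1 => c j x θ := fun j => by
    rw [← continuousOn_univ]
    exact (hτ.homogeneous j).smooth.continuousOn.comp
      (f := fun θ : Metric.sphere (0 : V (d + 1)) 1 => (x, (θ : V (d + 1)))) (by fun_prop)
      fun θ _ => ⟨hx, sphere_ne_zero θ⟩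
  have hcoord : Continuous fun θ : Metric.sphere (0 : V (d + 1)) 1 =>
      (((θ : V (d + 1)) i : ℝ) : ℂ) := by fun_prop
  set μ := (volume : Measure (V (d + 1))).toSphere with hμ
  -- The expansion, with all terms up to the index `N`.
  have hmain : HasFinitePart
      (fun R => ∑ j ∈ Finset.range (N + 1), sphereFlux (c j) i x * (R : ℂ) ^ (m - j + d))
      (sphereFlux (fun x ξ => ∑ᶠ (j : ℕ) (_ : m - (j : ℂ) = -(d : ℂ)), c j x ξ) i x) := by
    have h := HasFinitePart.sum (Finset.range (N + 1)) fun j _ =>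
      hasFinitePart_mul_cpow (sphereFlux (c j) i x) (m - j + d)
    convert h using 1
    rcases finsum_degree_eq m (-(d : ℂ)) with ⟨j₀, h₀, hf⟩ | ⟨hne, hf⟩
    · have hj₀ : j₀ ∈ Finset.range (N + 1) := by
        have := congrArg Complex.re h₀
        simp only [Complex.sub_re, Complex.natCast_re, Complex.neg_re] at this
        have : (j₀ : ℝ) < N := by linarith
        rw [Finset.mem_range]
        exact Nat.lt_succ_of_lt (by exact_mod_cast this)
      rw [Finset.sum_eq_single_of_mem j₀ hj₀ fun j _ hj => if_neg fun h => hj ?_,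
        if_pos (by linear_combination h₀)]
      · simp only [sphereFlux, hf]
      · have : (j : ℂ) = j₀ := by linear_combination h₀ - h
        exact_mod_cast this
    · rw [Finset.sum_eq_zero fun j _ => if_neg fun h => hne j (by linear_combination h)]
      simp [sphereFlux, hf]
  -- The remainder is `O(R ^ (d + p))`, and `d + p < 0`.
  have herr : Tendsto (fun R : ℝ => (R : ℂ) ^ d * sphereFlux (fun x ξ => τ x (R • ξ)) i x -
      ∑ j ∈ Finset.range (N + 1), sphereFlux (c j) i x * (R : ℂ) ^ (m - j + d)) atTop (𝓝 0) := by
    have hlim : Tendsto (fun R : ℝ => |C| * μ.real univ * R ^ (-(-(d + p)))) atTop (𝓝 0) := by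
      have := (tendsto_rpow_neg_atTop (y := -(d + p)) (by rw [hp]; linarith)).const_mul
        (|C| * μ.real univ)
      rwa [mul_zero] at this
    refine squeeze_zero_norm' ?_ hlim
    filter_upwards [eventually_ge_atTop 1] with R hR
    have hR0 : 0 < R := by linarith
    have hRc : (R : ℂ) ≠ 0 := by exact_mod_cast hR0.ne'
    have hEq : (R : ℂ) ^ d * sphereFlux (fun x ξ => τ x (R • ξ)) i x -
        ∑ j ∈ Finset.range (N + 1), sphereFlux (c j) i x * (R : ℂ) ^ (m - j + d) =
        (R : ℂ) ^ d * ∫ θ : Metric.sphere (0 : V (d + 1)) 1,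
          (τ x (R • (θ : V (d + 1))) - ∑ j ∈ Finset.range (N + 1),
            (χ x (R • (θ : V (d + 1))) : ℂ) * c j x (R • (θ : V (d + 1)))) *
              (((θ : V (d + 1)) i : ℝ) : ℂ) ∂μ := by
      have hpt : ∀ θ : Metric.sphere (0 : V (d + 1)) 1,
          (τ x (R • (θ : V (d + 1))) - ∑ j ∈ Finset.range (N + 1),
            (χ x (R • (θ : V (d + 1))) : ℂ) * c j x (R • (θ : V (d + 1)))) *
              (((θ : V (d + 1)) i : ℝ) : ℂ) =
          τ x (R • (θ : V (d + 1))) * (((θ : V (d + 1)) i : ℝ) : ℂ) -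
            ∑ j ∈ Finset.range (N + 1), (R : ℂ) ^ (m - j) *
              (c j x θ * (((θ : V (d + 1)) i : ℝ) : ℂ)) := fun θ => by
        have hn : ‖R • (θ : V (d + 1))‖ = R := norm_smul_sphere hR0 θ
        rw [sub_mul, Finset.sum_mul, hχ.eq_one x hx _ (hR.trans hn.ge)]
        congr 1
        refine Finset.sum_congr rfl fun j _ => ?_
        rw [(hτ.homogeneous j).homogeneous x hx θ (sphere_ne_zero θ) R hR0]
        push_cast
        ring
      simp only [hpt]
      have hi : ∀ j : ℕ, Integrable (fun θ : Metric.sphere (0 : V (d + 1)) 1 =>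
          (R : ℂ) ^ (m - j) * (c j x θ * (((θ : V (d + 1)) i : ℝ) : ℂ))) μ := fun j =>
        (integrable_of_continuous_sphere ((hcc j).mul hcoord)).const_mul _
      have hiτ : Integrable (fun θ : Metric.sphere (0 : V (d + 1)) 1 =>
          τ x (R • (θ : V (d + 1))) * (((θ : V (d + 1)) i : ℝ) : ℂ)) μ :=
        integrable_of_continuous_sphere (by fun_prop)
      rw [integral_sub hiτ (integrable_finsetSum _ fun j _ => hi j),
        integral_finsetSum _ fun j _ => hi j, mul_sub, Finset.mul_sum]
      congr 1
      refine Finset.sum_congr rfl fun j _ => ?_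
      rw [integral_const_mul, Complex.cpow_add _ _ hRc, Complex.cpow_natCast, sphereFlux]
      ring
    rw [hEq, norm_mul, norm_pow, Complex.norm_of_nonneg hR0.le]
    have hint : ‖∫ θ : Metric.sphere (0 : V (d + 1)) 1,
          (τ x (R • (θ : V (d + 1))) - ∑ j ∈ Finset.range (N + 1),
            (χ x (R • (θ : V (d + 1))) : ℂ) * c j x (R • (θ : V (d + 1)))) *
              (((θ : V (d + 1)) i : ℝ) : ℂ) ∂μ‖ ≤ |C| * R ^ p * μ.real univ := by
      refine norm_integral_le_of_norm_le_const (.of_forall fun θ => ?_)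
      have hn : ‖R • (θ : V (d + 1))‖ = R := norm_smul_sphere hR0 θ
      have h1 := hbound (R • (θ : V (d + 1)))
      rw [hn] at h1
      have h2 : ‖(((θ : V (d + 1)) i : ℝ) : ℂ)‖ ≤ 1 := by
        rw [Complex.norm_real]
        exact (PiLp.norm_apply_le _ i).trans (norm_eq_of_mem_sphere θ).le
      have hp0 : p ≤ 0 := by rw [hp]; linarith [Nat.cast_nonneg (α := ℝ) d]
      have h3 : (1 + R) ^ p ≤ R ^ p := Real.rpow_le_rpow_of_nonpos hR0 (by linarith) hp0
      rw [norm_mul]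
      calc _ ≤ C * (1 + R) ^ p * 1 :=
            mul_le_mul h1 h2 (norm_nonneg _) ((norm_nonneg _).trans h1)
        _ ≤ |C| * R ^ p := by
          rw [mul_one]
          exact mul_le_mul (le_abs_self C) h3 (by positivity) (abs_nonneg C)
    calc R ^ d * _ ≤ R ^ d * (|C| * R ^ p * μ.real univ) :=
          mul_le_mul_of_nonneg_left hint (by positivity)
      _ = |C| * μ.real univ * R ^ (-(-(d + p))) := by
        rw [neg_neg, Real.rpow_add hR0, Real.rpow_natCast]
        ring
  simpa using (hasFinitePart_of_tendsto_zero herr).add hmain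

/-- By the divergence theorem, the integral of `∂σ/∂ξ_i` over a ball in the fibre is the flux
through its boundary sphere. -/
theorem ballIntegral_partialXi {d : ℕ} {σ : V (d + 1) → V (d + 1) → ℂ} {x : V (d + 1)}
    (hσ : ContDiff ℝ ∞ (σ x)) (i : Fin (d + 1)) {R : ℝ} (hR : 0 < R) :
    ballIntegral (partialXi i σ) x R =
      (R : ℂ) ^ d * sphereFlux (fun x ξ => σ x (R • ξ)) i x := by
  have h := setIntegral_ball_fderiv (volume : Measure (V (d + 1))) (g := σ x)
    (hσ.of_le (by norm_cast)) (basisVec i) hR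
  rw [finrank_euclideanSpace_fin, Nat.add_sub_cancel] at h
  rw [ballIntegral]
  refine h.trans ?_
  rw [Complex.real_smul, Complex.ofReal_pow, sphereFlux]
  congr 2
  funext θ
  rw [basisVec, real_inner_comm, EuclideanSpace.inner_single_left, Complex.real_smul, mul_comm]
  simp

theorem IsHomComponent.hasFinitePart {d : ℕ} {U : Set (V (d + 1))}
    {σ h : V (d + 1) → V (d + 1) → ℂ} (hh : IsHomComponent U σ (-(d : ℂ)) h) (i : Fin (d + 1))
    {x : V (d + 1)} (hx : x ∈ U) :
    HasFinitePart (ballIntegral (partialXi i σ) x) (sphereFlux h i x) := by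
  obtain ⟨p, m, τ, c, hc, -, hσ, hcomp⟩ := hh
  have hτ : ∀ k, ContDiff ℝ ∞ (τ k x) := fun k => by
    rw [← contDiffOn_univ]
    exact (hc k).symbol.smooth.comp (f := fun ξ => (x, ξ)) (by fun_prop)
      fun ξ _ => ⟨hx, mem_univ ξ⟩
  have hσx : σ x = fun ξ => ∑ k, τ k x ξ := funext fun ξ => hσ x hx ξ
  have hsm : ContDiff ℝ ∞ (σ x) := by
    rw [hσx]
    exact ContDiff.sum fun k _ => hτ k
  have hflux : sphereFlux h i x = ∑ k, sphereFlux
      (fun x ξ => ∑ᶠ (j : ℕ) (_ : m k - (j : ℂ) = -(d : ℂ)), c k j x ξ) i x := by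
    have hint : ∀ k, Integrable (fun θ : Metric.sphere (0 : V (d + 1)) 1 =>
        (∑ᶠ (j : ℕ) (_ : m k - (j : ℂ) = -(d : ℂ)), c k j x θ) * (((θ : V (d + 1)) i : ℝ) : ℂ))
        (volume : Measure (V (d + 1))).toSphere := fun k => by
      rcases finsum_degree_eq (m k) (-(d : ℂ)) with ⟨j₀, -, hf⟩ | ⟨-, hf⟩
      · simp only [hf]
        refine integrable_of_continuous_sphere (Continuous.mul ?_ (by fun_prop))
        rw [← continuousOn_univ]
        exact ((hc k).homogeneous j₀).smooth.continuousOn.comp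
          (f := fun θ : Metric.sphere (0 : V (d + 1)) 1 => (x, (θ : V (d + 1)))) (by fun_prop)
          fun θ _ => ⟨hx, sphere_ne_zero θ⟩
      · simp [hf]
    simp only [sphereFlux]
    rw [← integral_finsetSum _ fun k _ => hint k]
    refine integral_congr_ae (.of_forall fun θ => ?_)
    simp only [hcomp x hx θ (sphere_ne_zero θ), Finset.sum_mul]
  rw [hflux]
  refine (HasFinitePart.sum Finset.univ fun k _ => (hc k).hasFinitePart_flux i hx).congr' ?_
  filter_upwards [eventually_gt_atTop 0] with R hR
  rw [ballIntegral_partialXi hsm i hR, ← Finset.mul_sum]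
  congr 1
  simp only [sphereFlux]
  rw [← integral_finsetSum _ fun k _ => integrable_of_continuous_sphere (by
    have := (hτ k).continuous
    fun_prop)]
  simp only [hσ x hx, Finset.sum_mul]

theorem IsHomComponent.continuousOn {n : ℕ} {U : Set (V n)} {σ h : V n → V n → ℂ} {a : ℂ}
    (hh : IsHomComponent U σ a h) : ContinuousOn (Function.uncurry h) (U ×ˢ {0}ᶜ) := by
  obtain ⟨p, m, τ, c, hc, -, -, hcomp⟩ := hh
  have hsum : ContinuousOn (fun q : V n × V n =>
      ∑ k, ∑ᶠ (j : ℕ) (_ : m k - (j : ℂ) = a), c k j q.1 q.2) (U ×ˢ {0}ᶜ) := by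
    refine continuousOn_finsetSum _ fun k _ => ?_
    rcases finsum_degree_eq (m k) a with ⟨j₀, -, hf⟩ | ⟨-, hf⟩
    · simp only [hf]
      exact ((hc k).homogeneous j₀).smooth.continuousOn
    · simp only [hf]
      exact continuousOn_const
  exact hsum.congr fun q hq => hcomp q.1 hq.1 q.2 hq.2

theorem IsHomComponent.hasCompactSupportIn {n : ℕ} {U : Set (V n)} {σ h : V n → V n → ℂ} {a : ℂ}
    (hh : IsHomComponent U σ a h) : HasCompactSupportIn U σ := by
  obtain ⟨p, m, τ, c, -, hK, hσ, -⟩ := hh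
  choose K hKc hKU hK0 using hK
  refine ⟨⋃ k, K k, isCompact_iUnion hKc, iUnion_subset hKU, fun x hx hxK ξ => ?_⟩
  rw [hσ x hx]
  exact Finset.sum_eq_zero fun k _ => hK0 k x hx (fun h => hxK (mem_iUnion.2 ⟨k, h⟩)) ξ

theorem IsHomComponent.fibreCutoff_eq {d : ℕ} {U : Set (V (d + 1))}
    {σ h : V (d + 1) → V (d + 1) → ℂ} (hh : IsHomComponent U σ (-(d : ℂ)) h) (i : Fin (d + 1))
    {x : V (d + 1)} (hx : x ∈ U) : fibreCutoff (partialXi i σ) x = sphereFlux h i x :=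
  (hh.hasFinitePart i hx).finitePart_eq

/-- The flux through the cosphere is continuous on `U`, and it vanishes where `σ` does because it is
the finite part of integrals of derivatives of `σ`. -/
theorem IsHomComponent.integrableOn_sphereFlux {d : ℕ} {U : Set (V (d + 1))} (hU : IsOpen U)
    {σ h : V (d + 1) → V (d + 1) → ℂ} (hh : IsHomComponent U σ (-(d : ℂ)) h) (i : Fin (d + 1)) :
    IntegrableOn (sphereFlux h i) U := by
  obtain ⟨K, hK, hKU, hK0⟩ := hh.hasCompactSupportIn
  have hzero : ∀ x ∈ U \ K, sphereFlux h i x = 0 := fun x hx => by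
    have hσx : σ x = fun _ => 0 := funext (hK0 x hx.1 hx.2)
    refine (hh.hasFinitePart i hx.1).unique ((hasFinitePart_of_tendsto_zero
      (tendsto_const_nhds (x := (0 : ℂ)))).congr' (.of_forall fun R => ?_))
    simp [ballIntegral, partialXi, hσx]
  refine IntegrableOn.of_forall_sdiff_eq_zero (s := K) ?_ hU.measurableSet hzero
  exact ((continuousOn_sphereFlux hh.continuousOn i).mono hKU).integrableOn_compact hK

end CutoffIBP

open CutoffIBP in
theorem mainTheorem8 (d : ℕ) (U : Set (V (d + 1))) (hU : IsOpen U)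
    (σ : V (d + 1) → V (d + 1) → ℂ) (hσ : σ ∈ CScom U) (i : Fin (d + 1)) :
    (∀ x ∈ U, ∃ c : ℂ, HasFinitePart (ballIntegral (partialXi i σ) x) c) ∧
    IntegrableOn (fibreCutoff (partialXi i σ)) U ∧
    (∃ h, IsHomComponent U σ (-((d + 1 : ℕ) : ℂ) + 1) h) ∧
    (∀ h, IsHomComponent U σ (-((d + 1 : ℕ) : ℂ) + 1) h →
      IntegrableOn (fibreCosphere h i) U ∧
      cutoffIntegral U (partialXi i σ) = (-1 : ℂ) ^ (i : ℕ) * cosphereIntegral U h i) ∧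
    (σ ∈ CScomNonInt U → cutoffIntegral U (partialXi i σ) = 0) := by
  have ha : (-((d + 1 : ℕ) : ℂ) + 1) = -(d : ℂ) := by push_cast; ring
  rw [ha]
  obtain ⟨h₀, hh₀⟩ := exists_isHomComponent hσ (-(d : ℂ))
  have hcut : ∀ h, IsHomComponent U σ (-(d : ℂ)) h →
      cutoffIntegral U (partialXi i σ) = ∫ x in U, sphereFlux h i x := fun h hh =>
    setIntegral_congr_fun hU.measurableSet fun x hx => hh.fibreCutoff_eq i hx
  refine ⟨fun x hx => ⟨_, hh₀.hasFinitePart i hx⟩, ?_, ⟨h₀, hh₀⟩, fun h hh => ⟨?_, ?_⟩,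
    fun hni => ?_⟩
  · exact (hh₀.integrableOn_sphereFlux hU i).congr_fun
      (fun x hx => (hh₀.fibreCutoff_eq i hx).symm) hU.measurableSet
  · simp only [IntegrableOn, funext (fibreCosphere_eq h i)]
    exact (hh.integrableOn_sphereFlux hU i).const_mul _
  · simp only [hcut h hh, cosphereIntegral, fibreCosphere_eq, integral_const_mul]
    -- The orientation sign enters twice.
    rw [← mul_assoc, ← mul_pow]
    simp
  · have h0 : IsHomComponent U σ (-(d : ℂ)) 0 := by
      have := isHomComponent_zero_of_mem_CScomNonInt hni (-(d : ℤ))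
      push_cast at this
      exact this
    rw [hcut 0 h0]
    simp [sphereFlux]
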